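/- **Lemma 6.3.** Conventions. Filters on a set $X$ are families of non-empty sets, ordered by inclusion. A *convergence* $\xi$ on $X$ is a relation $x\in\lim_\xi\mathcal F$ between points $x$ and filters $\mathcal F$ on $X$ such that $\mathcal F\subset\mathcal G$ implies $\lim_\xi\mathcal F\subset\lim_\xi\mathcal G$, and every principal ultrafilter $\{x\}^{\uparrow}$ converges to $x$. Write $\xi\ge\theta$ if $\lim_\xi\mathcal F\subset\lim_\theta\mathcal F$ for every $\mathcal F$. A topology is identified with the convergence in which $\mathcal F$ converges to $x$ iff $\mathcal F$ contains every neighbourhood of $x$. The *topological modification* $\mathrm T\xi$ is the topology whose open sets are the sets $O$ that belong to every filter having a $\xi$-limit in $O$. The product $\xi\times\tau$ is the coarsest convergence making both projections continuous. A convergence $\xi$ is a *pretopology* if for every $x$ the intersection of all filters that converge to $x$ converges to $x$. It has *countable character* if every filter $\mathcal F$ with $x\in\lim_\xi\mathcal F$ contains a filter $\mathcal H$ that has a countable base and satisfies $x\in\lim_\xi\mathcal H$. It has *countable $\mathrm S_0$-character* if $\sigma\ge\xi\ge\mathrm T\sigma$ for some pretopology $\sigma$ of countable character. $\mathrm{Epi}_{\mathrm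 I_1}\xi$ is the coarsest of the convergences $\theta$ on the same set such that $\mathrm T(\xi\times\tau)=\mathrm T(\theta\times\tau)$ for every convergence $\tau$ of countable character (on any set). A set $K$ is *countably $\sigma$-compact* if for every countably based filter $\mathcal H$ all of whose elements meet $K$ there is an ultrafilter $\mathcal U\supset\mathcal H$ with $\lim_\sigma\mathcal U\cap K\ne\emptyset$. A convergence $\xi$ is *locally countably $\sigma$-compact* if every $\xi$-convergent filter contains a countably $\sigma$-compact set, and *locally countably compact* if it is locally countably $\xi$-compact. Statement. Let $\xi$ be a regular Hausdorff topology that is locally countably compact and has countable $\mathrm S_0$-character. Then $\xi=\mathrm T\sigma$ for some pretopology $\sigma$ of countable character, and for every such $\sigma$ one has $\xi=\mathrm{Epi}_{\mathrm I_1}\sigma$, and $\xi$ is locally countably $\mathrm{Epi}_{\mathrm I_1}\sigma$-compact. -/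

import Mathlib

open Filter Topology

universe u v w

/-- A convergence on the set `X`: a relation between filters and points which is monotone (a filter
finer than a converging one converges to the same points) and for which principal ultrafilters
converge. In Mathlib `G ≤ F` means that `G` is finer than `F`, and the degenerate filter `⊥`
is a filter. By the two laws `⊥` converges to every point, so it carries no information, and
a convergence in this sense is exactly a convergence defined on the non-degenerate filters. -/
@[ext]
structure Convergence (X : Type u) where
  /-- The set of limits of a filter. -/
  lim : Filter X → Set X
  mono : ∀ {F G : Filter X}, G ≤ F → lim F ⊆ lim G
  pure_mem : ∀ x : X, x ∈ lim (pure x)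

namespace Convergence

variable {X : Type u} {Y : Type v}

/-- `θ ≤ ξ` means that `θ` is coarser than `ξ` (and `ξ` finer than `θ`). -/
instance : PartialOrder (Convergence X) where
  le θ ξ := ∀ F : Filter X, ξ.lim F ⊆ θ.lim F
  le_refl _ _ := subset_rfl
  le_trans _ _ _ h₁ h₂ F := (h₂ F).trans (h₁ F)
  le_antisymm _ _ h₁ h₂ := Convergence.ext (funext fun F => (h₂ F).antisymm (h₁ F))

/-- The convergence of a topology: `F` converges to `x` iff `F` is finer than the neighbourhood
filter of `x`. -/
def ofTopology (t : TopologicalSpace X) : Convergence X where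
  lim F := {x | F ≤ @nhds X t x}
  mono h _ hx := h.trans hx
  pure_mem x := @pure_le_nhds X t x

/-- `O` is `ξ`-open if it belongs to every filter that converges to some point of `O`. -/
def IsOpenSet (ξ : Convergence X) (O : Set X) : Prop :=
  ∀ F : Filter X, (ξ.lim F ∩ O).Nonempty → O ∈ F

/-- The topology formed by the `ξ`-open sets. -/
@[reducible] def topology (ξ : Convergence X) : TopologicalSpace X where
  IsOpen := ξ.IsOpenSet
  isOpen_univ _ _ := univ_mem
  isOpen_inter := by
    rintro s t hs ht F ⟨x, hx, hxs, hxt⟩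
    exact inter_mem (hs F ⟨x, hx, hxs⟩) (ht F ⟨x, hx, hxt⟩)
  isOpen_sUnion := by
    rintro S hS F ⟨x, hx, s, hs, hxs⟩
    exact mem_of_superset (hS s hs F ⟨x, hx, hxs⟩) (Set.subset_sUnion_of_mem hs)

/-- The topological modification `T ξ`, as a convergence. -/
def T (ξ : Convergence X) : Convergence X := ofTopology ξ.topology

/-- The vicinity filter of `x`: the finest filter coarser than every filter converging to `x`. -/
def vicinity (ξ : Convergence X) (x : X) : Filter X := sSup {F | x ∈ ξ.lim F}

/-- `ξ` is a pretopology if every vicinity filter converges to its point. -/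
def IsPretopology (ξ : Convergence X) : Prop := ∀ x, x ∈ ξ.lim (ξ.vicinity x)

/-- The modification of countable character `I₁ ξ`: `F` converges to `x` for `I₁ ξ` iff `F` is finer
than some countably based filter that converges to `x` for `ξ`. -/
def I₁ (ξ : Convergence X) : Convergence X where
  lim F := {x | ∃ H : Filter X, H.IsCountablyGenerated ∧ F ≤ H ∧ x ∈ ξ.lim H}
  mono := by
    rintro F G hGF x ⟨H, hH, hFH, hx⟩
    exact ⟨H, hH, hGF.trans hFH, hx⟩
  pure_mem x := ⟨pure x, inferInstance, le_rfl, ξ.pure_mem x⟩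

/-- `ξ` has countable character: every convergent filter is finer than a countably based filter
with the same limit. -/
def HasCountableCharacter (ξ : Convergence X) : Prop :=
  ∀ (F : Filter X), ∀ x ∈ ξ.lim F,
    ∃ H : Filter X, H.IsCountablyGenerated ∧ F ≤ H ∧ x ∈ ξ.lim H

/-- The convergences of countable character are the fixed points of `I₁`. -/
theorem hasCountableCharacter_iff (ξ : Convergence X) :
    ξ.HasCountableCharacter ↔ ξ = ξ.I₁ := by
  constructor
  · intro h
    refine le_antisymm (fun F x hx => ?_) (fun F x hx => h F x hx)
    obtain ⟨H, _, hFH, hx⟩ := hx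
    exact ξ.mono hFH hx
  · intro h F x hx
    rw [h] at hx
    exact hx

/-- `ξ` has countable `S₀`-character: there is a pretopology `σ` of countable character with
`σ ≥ ξ ≥ T σ`. -/
def HasCountableS₀Character (ξ : Convergence X) : Prop :=
  ∃ σ : Convergence X, σ.IsPretopology ∧ σ.HasCountableCharacter ∧ ξ ≤ σ ∧ σ.T ≤ ξ

/-- The product convergence: the coarsest convergence making both projections continuous. -/
def prod (ξ : Convergence X) (τ : Convergence Y) : Convergence (X × Y) where
  lim F := {p | p.1 ∈ ξ.lim (map Prod.fst F) ∧ p.2 ∈ τ.lim (map Prod.snd F)}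
  mono h _ hp := ⟨ξ.mono (map_mono h) hp.1, τ.mono (map_mono h) hp.2⟩
  pure_mem p := ⟨ξ.pure_mem p.1, τ.pure_mem p.2⟩

/-- The convergences `θ` on `X` with `T (ξ × τ) = T (θ × τ)` for every convergence `τ = I₁ τ`.
The underlying sets of the convergences `τ` range over a universe at least as large as that
of `X`. -/
def epiClass (ξ : Convergence X) : Set (Convergence X) :=
  {θ | ∀ (Z : Type (max u w)) (τ : Convergence Z), τ = τ.I₁ → (ξ.prod τ).T = (θ.prod τ).T}

/-- `Epi_{I₁} ξ`, the coarsest of the convergences `θ` in `epiClass ξ`. It is constructed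
as their infimum in the lattice of convergences; see `isLeast_epi`. -/
def epi (ξ : Convergence X) : Convergence X where
  lim F := {x | ∃ θ ∈ epiClass.{u, w} ξ, x ∈ θ.lim F}
  mono := by
    rintro F G h x ⟨θ, hθ, hx⟩
    exact ⟨θ, hθ, θ.mono h hx⟩
  pure_mem x := ⟨ξ, fun _ _ _ => rfl, ξ.pure_mem x⟩

/-- The topological modification determines the open sets. -/
theorem isOpenSet_iff_of_T_eq {ξ θ : Convergence X} (h : ξ.T = θ.T) (O : Set X) :
    ξ.IsOpenSet O ↔ θ.IsOpenSet O := by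
  have key : ∀ x, @nhds X ξ.topology x = @nhds X θ.topology x := fun x => by
    have h' : ∀ F, F ≤ @nhds X ξ.topology x ↔ F ≤ @nhds X θ.topology x := fun F =>
      Set.ext_iff.1 (congrFun (congrArg Convergence.lim h) F) x
    exact le_antisymm ((h' _).1 le_rfl) ((h' _).2 le_rfl)
  have ht : ξ.topology = θ.topology := TopologicalSpace.ext_nhds key
  change @IsOpen X ξ.topology O ↔ @IsOpen X θ.topology O
  rw [ht]

/-- `Epi_{I₁} ξ` is indeed the coarsest convergence in `epiClass ξ`. -/
theorem isLeast_epi (ξ : Convergence X) : IsLeast (epiClass.{u, w} ξ) (epi.{u, w} ξ) := by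
  constructor
  · intro Z τ hτ
    have : (ξ.prod τ).topology = ((epi.{u, w} ξ).prod τ).topology := by
      apply TopologicalSpace.ext
      funext O
      apply propext
      constructor
      · rintro hO F ⟨p, ⟨⟨θ, hθ, h₁⟩, h₂⟩, hp⟩
        exact (isOpenSet_iff_of_T_eq (hθ Z τ hτ) O).1 hO F ⟨p, ⟨h₁, h₂⟩, hp⟩
      · rintro hO F ⟨p, ⟨h₁, h₂⟩, hp⟩
        exact hO F ⟨p, ⟨⟨ξ, fun _ _ _ => rfl, h₁⟩, h₂⟩, hp⟩
    exact congrArg ofTopology this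
  · intro θ hθ F x hx
    exact ⟨θ, hθ, hx⟩

/-- `K` is countably `ξ`-compact: for every countably based filter `H` that meshes with `K`
there is an ultrafilter finer than `H` with a limit in `K`. -/
def IsCountablyCompactSet (ξ : Convergence X) (K : Set X) : Prop :=
  ∀ H : Filter X, H.IsCountablyGenerated → (∀ A ∈ H, (A ∩ K).Nonempty) →
    ∃ U : Ultrafilter X, (U : Filter X) ≤ H ∧ (ξ.lim U ∩ K).Nonempty

/-- `ξ` is locally countably `σ`-compact: every `ξ`-convergent (non-degenerate) filter has
a countably `σ`-compact element. -/
def IsLocallyCountablyCompactFor (ξ σ : Convergence X) : Prop :=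
  ∀ F : Filter X, F.NeBot → (ξ.lim F).Nonempty → ∃ K ∈ F, σ.IsCountablyCompactSet K

/-- `ξ` is locally countably compact: it is locally countably `ξ`-compact. -/
def IsLocallyCountablyCompact (ξ : Convergence X) : Prop := ξ.IsLocallyCountablyCompactFor ξ

end Convergence

namespace Convergence

/-! Sandwiching `ξ` between `σ` and `T σ` forces `ξ = T σ`. Testing against a one-point `τ` puts
every member of `epiClass σ` above `T σ`, so it remains to place `ξ` itself in that class. This is
the tube lemma `mem_nhds_prod_of_isOpenSet_prod`: if no rectangle fits in `O`, countable compactness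
makes a sequence of bad points cluster; since `ξ = T σ`, some σ-convergent filter then lives on that
sequence, and σ-convergence forces all but finitely many of its points out of that filter. -/

theorem isOpenSet_ofTopology {X : Type u} (t : TopologicalSpace X) (O : Set X) :
    (ofTopology t).IsOpenSet O ↔ IsOpen O := by
  constructor
  · intro h
    exact isOpen_iff_mem_nhds.2 fun x hx => h (𝓝 x) ⟨x, le_refl (𝓝 x), hx⟩
  · rintro h F ⟨x, hF, hx⟩
    exact hF (h.mem_nhds hx)

theorem isOpenSet_T {X : Type u} (σ : Convergence X) (O : Set X) :
    σ.T.IsOpenSet O ↔ σ.IsOpenSet O :=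
  isOpenSet_ofTopology σ.topology O

theorem T_congr {X : Type u} {ξ θ : Convergence X}
    (h : ∀ O, ξ.IsOpenSet O ↔ θ.IsOpenSet O) : ξ.T = θ.T :=
  congrArg ofTopology (TopologicalSpace.ext (funext fun O => propext (h O)))

theorem IsOpenSet.mono {X : Type u} {ξ θ : Convergence X} (h : θ ≤ ξ) {O : Set X}
    (hO : θ.IsOpenSet O) : ξ.IsOpenSet O := by
  rintro F ⟨x, hF, hx⟩
  exact hO F ⟨x, h F hF, hx⟩

theorem T_le {X : Type u} (σ : Convergence X) : σ.T ≤ σ := by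
  intro F x hx
  refine (@le_nhds_iff X σ.topology x F).2 fun O hxO hO => ?_
  exact hO F ⟨x, hx, hxO⟩

/-- The topological modification is the finest topology below a convergence. -/
theorem ofTopology_le_T {X : Type u} {t : TopologicalSpace X} {σ : Convergence X}
    (h : ofTopology t ≤ σ) : ofTopology t ≤ σ.T := by
  intro F x hx
  refine le_nhds_iff.2 fun O hxO hO => ?_
  have hO' : σ.IsOpenSet O := ((isOpenSet_ofTopology t O).2 hO).mono h
  exact hx (@IsOpen.mem_nhds X σ.topology x O hO' hxO)

/-- A member of `epiClass σ` has the same open sets as `σ`. -/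
theorem T_le_of_mem_epiClass {X : Type u} {σ θ : Convergence X}
    (h : θ ∈ epiClass.{u, w} σ) : σ.T ≤ θ := by
  -- On one point, the product with `τ` has the same open sets as the first factor, up to cylinders.
  let τ : Convergence PUnit.{max u w + 1} :=
    ⟨fun _ => Set.univ, fun _ => subset_rfl, fun _ => Set.mem_univ _⟩
  have hτ : τ = τ.I₁ := by
    rw [← hasCountableCharacter_iff]
    intro F x hx
    exact ⟨⊤, inferInstance, le_top, Set.mem_univ x⟩
  have hT : σ.T = θ.T := by
    refine T_congr fun O => ?_
    have key : ∀ ζ : Convergence X,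
        (ζ.prod τ).IsOpenSet (Prod.fst ⁻¹' O) ↔ ζ.IsOpenSet O := by
      intro ζ
      constructor
      · rintro hO F ⟨x, hF, hx⟩
        have := hO (map (fun a => (a, PUnit.unit)) F) ⟨(x, PUnit.unit), ⟨?_, ?_⟩, hx⟩
        · exact this
        · rw [map_map]
          exact hF
        · exact Set.mem_univ _
      · rintro hO F ⟨p, ⟨hF, -⟩, hp⟩
        exact hO _ ⟨p.1, hF, hp⟩
    rw [← key σ, ← key θ]
    exact isOpenSet_iff_of_T_eq (h _ τ hτ) _
  rw [hT]
  exact θ.T_le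

/-- A tube lemma: a set open for `σ × τ` contains a rectangle around each of its points, where the
first side is a neighbourhood for the locally countably compact topology `T σ` and the second side
belongs to a given countably based filter. -/
theorem mem_nhds_prod_of_isOpenSet_prod {X : Type u} {Z : Type v} [t : TopologicalSpace X]
    [RegularSpace X] [T2Space X] (hloc : (ofTopology t).IsLocallyCountablyCompact)
    {σ : Convergence X} (hσ : ofTopology t = σ.T) {τ : Convergence Z} {O : Set (X × Z)}
    (hO : (σ.prod τ).IsOpenSet O) {x : X} {z : Z} (hxz : (x, z) ∈ O) {H : Filter Z}
    [H.IsCountablyGenerated] (hH : z ∈ τ.lim H) : O ∈ 𝓝 x ×ˢ H := by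
  have hopen : ∀ V : Set X, IsOpen V ↔ σ.IsOpenSet V := fun V => by
    rw [← isOpenSet_ofTopology t V, hσ, isOpenSet_T]
  have hlim : ∀ {F : Filter X} {y}, y ∈ σ.lim F → F ≤ 𝓝 y := fun {F y} h => by
    have := σ.T_le F h
    rwa [← hσ] at this
  have hprod : ∀ {F : Filter X} {y}, y ∈ σ.lim F → (y, z) ∈ O → O ∈ F ×ˢ H := fun h hy =>
    hO _ ⟨_, ⟨σ.mono tendsto_fst h, τ.mono tendsto_snd hH⟩, hy⟩
  have hsec : IsOpen {y | (y, z) ∈ O} := by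
    rw [hopen]
    rintro F ⟨y, hF, hy⟩
    have := hO (map (fun a => (a, z)) F) ⟨(y, z), ⟨?_, ?_⟩, hy⟩
    · exact this
    · rw [map_map]
      exact hF
    · rw [map_map]
      exact τ.mono (tendsto_const_pure) (τ.pure_mem z)
  obtain ⟨K, hKx, hK⟩ := hloc (𝓝 x) inferInstance ⟨x, le_refl (𝓝 x)⟩
  -- A closed `C` keeps the limits `p` and `y` found below inside the section of `O` at `z`.
  obtain ⟨C, hCx, hC, hCO⟩ := exists_mem_nhds_isClosed_subset (hsec.mem_nhds hxz)
  obtain ⟨h, hh⟩ := H.exists_antitone_basis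
  let W : ℕ → Set X := fun n => {y | ∀ b ∈ h n, (y, b) ∈ O}
  have hWmono : Monotone W := fun m n hmn y hy b hb => hy b (hh.antitone hmn hb)
  have hW : ∀ {F : Filter X} {y}, y ∈ σ.lim F → y ∈ C → ∃ n, W n ∈ F := by
    intro F y hF hy
    obtain ⟨A, hA, B, hB, hAB⟩ := mem_prod_iff.1 (hprod hF (hCO hy))
    obtain ⟨n, hn⟩ := hh.mem_iff.1 hB
    exact ⟨n, mem_of_superset hA fun a ha b hb => hAB ⟨ha, hn hb⟩⟩
  by_contra hcon
  have hex : ∀ n, ∃ y, y ∈ K ∩ C ∧ y ∉ W n := by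
    intro n
    by_contra! hn
    refine hcon (mem_of_superset (prod_mem_prod (inter_mem hKx hCx) (hh.mem n)) ?_)
    rintro ⟨a, b⟩ ⟨ha, hb⟩
    exact hn a ha b hb
  choose s hsKC hsW using hex
  obtain ⟨U, hU, p, hUp, -⟩ := hK (map s atTop) inferInstance fun A hA => by
    have hA' : ∀ᶠ n in atTop, s n ∈ A := hA
    obtain ⟨n, hn⟩ := hA'.exists
    exact ⟨s n, hn, (hsKC n).1⟩
  have hUp : (U : Filter X) ≤ 𝓝 p := hUp
  have hrange : Set.range s ∈ (U : Filter X) := hU range_mem_map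
  have hpC : p ∈ C := hC.mem_of_tendsto (f := id) hUp
    (mem_of_superset hrange (Set.range_subset_iff.2 fun n => (hsKC n).2))
  have hfin : ∀ᶠ n in atTop, s n ≠ p := by
    obtain ⟨m, hm⟩ := hW (σ.pure_mem p) hpC
    filter_upwards [eventually_ge_atTop m] with n hn hsp
    exact hsW n (hsp ▸ hWmono hn hm)
  -- Without `p`, `S` still belongs to `U`, so it is not closed. `U` need not σ-converge; but `T
  -- σ`-closedness is tested by σ-convergent filters, which yields `F` and a limit `y ∉ S`, possibly
  -- different from `p`.
  let S : Set X := {y | y ∈ Set.range s ∧ y ≠ p}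
  have hSU : S ∈ (U : Filter X) := inter_mem hrange (hU hfin)
  have hSopen : ¬ IsOpen Sᶜ := fun hS => by
    have : Sᶜ ∈ (U : Filter X) := hUp (hS.mem_nhds fun hp => hp.2 rfl)
    exact U.compl_notMem_iff.2 hSU this
  rw [hopen] at hSopen
  simp only [IsOpenSet, not_forall] at hSopen
  obtain ⟨F, ⟨y, hFy, hyS⟩, hFS⟩ := hSopen
  let G : Filter X := F ⊓ 𝓟 S
  have hG : G.NeBot := by
    rw [neBot_iff]
    intro hbot
    exact hFS (by simpa using mem_iff_inf_principal_compl.2 (by rwa [compl_compl] : F ⊓ 𝓟 Sᶜᶜ = ⊥))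
  have hGy : y ∈ σ.lim G := σ.mono inf_le_left hFy
  have hSG : S ∈ G := mem_inf_of_right (mem_principal_self S)
  have hGn : G ≤ 𝓝 y := hlim hGy
  have hyC : y ∈ C := hC.mem_of_tendsto (f := id) (b := G) hGn
    (mem_of_superset hSG fun _ ha => by
      obtain ⟨⟨n, rfl⟩, -⟩ := ha
      exact (hsKC n).2)
  obtain ⟨m, hm⟩ := hW hGy hyC
  -- `W m` contains `s n` only for `n < m`, so `G` would live on a finite set avoiding its own limit
  -- `y`.
  have hTfin : (s '' Set.Iio m \ {y}).Finite := ((Set.finite_Iio m).image s).sdiff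
  have hTy : (s '' Set.Iio m \ {y})ᶜ ∈ G :=
    hGn (hTfin.isClosed.isOpen_compl.mem_nhds fun hy => hy.2 rfl)
  obtain ⟨a, ⟨haS, haW⟩, haT⟩ := hG.nonempty_of_mem (inter_mem (inter_mem hSG hm) hTy)
  have hay : a ≠ y := fun e => hyS (e ▸ haS)
  obtain ⟨⟨n, rfl⟩, -⟩ := haS
  refine haT ⟨⟨n, ?_, rfl⟩, hay⟩
  by_contra hn
  exact hsW n (hWmono (not_lt.1 hn) haW)

theorem ofTopology_mem_epiClass {X : Type u} [t : TopologicalSpace X]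
    [RegularSpace X] [T2Space X] (hloc : (ofTopology t).IsLocallyCountablyCompact)
    {σ : Convergence X} (hσ : ofTopology t = σ.T) : ofTopology t ∈ epiClass.{u, w} σ := by
  intro Z τ hτ
  refine T_congr fun O => ⟨?_, ?_⟩
  · rintro hO F ⟨⟨x, z⟩, ⟨hx, hz⟩, hxz⟩
    obtain ⟨H, _, hFH, hH⟩ := (hasCountableCharacter_iff τ).2 hτ _ _ hz
    exact (le_prod.2 ⟨hx, hFH⟩) (mem_nhds_prod_of_isOpenSet_prod hloc hσ hO hxz hH)
  · refine IsOpenSet.mono fun F p hp => ?_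
    rw [hσ]
    exact ⟨σ.T_le _ hp.1, hp.2⟩

end Convergence

theorem lemma6p3 {X : Type u} [t : TopologicalSpace X] [RegularSpace X] [T2Space X]
    (hchar : (Convergence.ofTopology t).HasCountableS₀Character)
    (hloc : (Convergence.ofTopology t).IsLocallyCountablyCompact) :
    (∃ σ : Convergence X, σ.IsPretopology ∧ σ.HasCountableCharacter ∧
      Convergence.ofTopology t = σ.T) ∧
    ∀ σ : Convergence X, σ.IsPretopology → σ.HasCountableCharacter →
      Convergence.ofTopology t = σ.T →
        Convergence.ofTopology t = Convergence.epi.{u, w} σ ∧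
        (Convergence.ofTopology t).IsLocallyCountablyCompactFor (Convergence.epi.{u, w} σ) := by
  constructor
  · obtain ⟨σ, hpre, hcc, hle, hTle⟩ := hchar
    exact ⟨σ, hpre, hcc, le_antisymm (Convergence.ofTopology_le_T hle) hTle⟩
  · intro σ _ _ hσ
    have hepi : Convergence.ofTopology t = Convergence.epi.{u, w} σ := by
      refine le_antisymm ?_ ?_
      · rw [hσ]
        exact Convergence.T_le_of_mem_epiClass (Convergence.isLeast_epi.{u, w} σ).1
      · exact (Convergence.isLeast_epi.{u, w} σ).2
          (Convergence.ofTopology_mem_epiClass hloc hσ)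
    exact ⟨hepi, hepi ▸ hloc⟩
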